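/- **Setting.** Consider $x(t+1)=Ax(t)+Bu(t)$, $t\in\mathbb Z_+$, where $A\in\mathbb R^{n\times n}$ is in Jordan form with distinct real eigenvalues $\lambda_1,\dots,\lambda_r$: $A=\mathrm{diag}\{A^{\ell,h}\}$, where $A^{\ell,h}$, $1\le h\le g_\ell$, are the upper triangular Jordan miniblocks of $\lambda_\ell$, of sizes $d^{\ell,h}\ge1$. Call $\lambda_\ell$ unstable if $|\lambda_\ell|\ge1$. There are $N$ agents, with outputs $y_i(t)=C_ix(t)$, connected by a directed graph with nonnegative weighted adjacency matrix $\mathcal A$ (zero diagonal), neighbour sets $\mathcal N_i=\{j:[\mathcal A]_{i,j}>0\}$ and Laplacian $\mathcal L=\mathrm{diag}\{\sum_j[\mathcal A]_{i,j}\}_i-\mathcal A$. Let $C_i^{\ell,h}$ be the block of columns of $C_i$ corresponding to $A^{\ell,h}$ and, if it is nonzero, let $t_i^{\ell,h}$ be the index of its first nonzero column. Let $\mathcal V_1^{\ell,h},\mathcal V_2^{\ell,h},\mathcal V_3^{\ell,h}$ be the sets of agents $i$ with $C_i^{\ell,h}=0$; with $C_i^{\ell,h}\neq0$ and $t_i^{\ell,h}>1$;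 with $C_i^{\ell,h}\ne0$ and $t_i^{\ell,h}=1$, respectively. For each agent $i$ let $z_{i,u}$ collect, over all miniblocks of unstable eigenvalues, all the entries of $x^{\ell,h}$ if $i\in\mathcal V_1^{\ell,h}$ and the first $t_i^{\ell,h}-1$ entries of $x^{\ell,h}$ if $i\in\mathcal V_2^{\ell,h}$; let $z_{i,d}$ collect the remaining entries of $x$. Let $Q_i$ be the permutation matrix with $x=Q_i\begin{bmatrix}z_{i,u}\\z_{i,d}\end{bmatrix}$, so that $$Q_i^\top AQ_i=\begin{bmatrix}F_{i,u}&F_{i,*}\\0&F_{i,d}\end{bmatrix},\qquad C_iQ_i=\begin{bmatrix}0&H_{i,d}\end{bmatrix},\qquad Q_i^\top B=\begin{bmatrix}G_{i,u}\\G_{i,d}\end{bmatrix}.$$ A distributed observer of non-augmented form consists of real matrices $L_{i,d}$, $i=1,\dots,N$, and of real gains $k^{\ell,h}$, one for each miniblock and common to all agents. Its estimates are $\hat x_i=Q_i\begin{bmatrix}\hat z_{i,u}\\\hat z_{i,d}\end{bmatrix}$, where $$\hat z_{i,d}(t+1)=F_{i,d}\hat z_{i,d}(t)+G_{i,d}u(t)+L_{i,d}\bigl(y_i(t)-H_{i,d}\hat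 z_{i,d}(t)\bigr),$$ $$\hat z_{i,u}(t+1)=F_{i,u}\hat z_{i,u}(t)+F_{i,*}\hat z_{i,d}(t)+G_{i,u}u(t)+K_iF_{i,u}\sum_{j\in\mathcal N_i}[\mathcal A]_{i,j}\begin{bmatrix}I&0\end{bmatrix}Q_i^\top\bigl(\hat x_j(t)-\hat x_i(t)\bigr),$$ $K_i$ being the diagonal matrix with entry $k^{\ell,h}$ at every entry of $z_{i,u}$ that belongs to $x^{\ell,h}$. It is required that $x(t)-\hat x_i(t)\to0$ as $t\to+\infty$ for every $i$, every initial state, all initial estimates and every input. **Theorem.** Assume that 1. the pair $\bigl(A,\mathrm{col}\{C_1,\dots,C_N\}\bigr)$ is detectable, and 2. for every agent $i$ and every unstable $\lambda_\ell$, the vectors formed by the $t_i^{\ell,h}$-th column of $C_i^{\ell,h}$, for all $h$ with $C_i^{\ell,h}\ne0$, are linearly independent. Then a distributed observer of the above form exists if and only if, for every miniblock $(\ell,h)$ of an unstable eigenvalue, there is $k^{\ell,h}\in\mathbb R$ such that $$|1-k^{\ell,h}\mu|<\frac1{|\lambda_\ell|}\qquad\text{for all }\mu\in\sigma\bigl(S^{\ell,h}(\mathcal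 L^{\ell,h}\otimes I_{d^{\ell,h}})(S^{\ell,h})^\top\bigr)\subset\mathbb C.$$ Here $\mathcal L^{\ell,h}$ is $\mathcal L$ with the rows and columns indexed in $\mathcal V_3^{\ell,h}$ deleted, and $S^{\ell,h}=\mathrm{diag}\{S_i^{\ell,h}\}_{i\in\mathcal V_1^{\ell,h}\cup\mathcal V_2^{\ell,h}}$ with $S_i^{\ell,h}=I_{d^{\ell,h}}$ for $i\in\mathcal V_1^{\ell,h}$ and $S_i^{\ell,h}=\begin{bmatrix}I_{t_i^{\ell,h}-1}&0\end{bmatrix}$ for $i\in\mathcal V_2^{\ell,h}$. -/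

import Mathlib

open Filter Topology
open scoped Kronecker

noncomputable section

namespace DistributedObserver

/-- The combinatorial data of a real matrix in Jordan form with real spectrum: the `r` distinct
eigenvalues `eig ℓ`, the number `g ℓ ≥ 1` of miniblocks of each eigenvalue, and the size
`d ℓ h ≥ 1` of each miniblock. -/
structure JordanStructure where
  r : ℕ
  eig : Fin r → ℝ
  eig_injective : Function.Injective eig
  g : Fin r → ℕ
  g_pos : ∀ ℓ, 0 < g ℓ
  d : (ℓ : Fin r) → Fin (g ℓ) → ℕ
  d_pos : ∀ ℓ h, 0 < d ℓ h

/-- A weighted digraph on `N` nodes given by its nonnegative adjacency matrix with zero diagonal;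
`(j, i)` is an edge if and only if `adj i j > 0`. -/
structure WeightedDigraph (N : ℕ) where
  adj : Matrix (Fin N) (Fin N) ℝ
  adj_nonneg : ∀ i j, 0 ≤ adj i j
  adj_self : ∀ i, adj i i = 0

/-- The set of (in-)neighbours of a node. -/
def WeightedDigraph.neighbors {N : ℕ} (G : WeightedDigraph N) (i : Fin N) : Finset (Fin N) :=
  Finset.univ.filter fun j => 0 < G.adj i j

/-- The Laplacian: in-degree matrix minus adjacency matrix. -/
def WeightedDigraph.laplacian {N : ℕ} (G : WeightedDigraph N) : Matrix (Fin N) (Fin N) ℝ :=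
  Matrix.diagonal (fun i => ∑ j, G.adj i j) - G.adj

namespace JordanStructure

variable (J : JordanStructure)

/-- Indices `(ℓ, h)` of the Jordan miniblocks. -/
abbrev Mini : Type := Σ ℓ : Fin J.r, Fin (J.g ℓ)

/-- The size of the miniblock `b = (ℓ, h)`. -/
abbrev size (b : J.Mini) : ℕ := J.d b.1 b.2

/-- Indices of the entries of the state vector: a miniblock, and a position in it. -/
abbrev State : Type := Σ b : J.Mini, Fin (J.size b)

/-- The eigenvalue `λ_ℓ` is unstable. -/
def Unstable (ℓ : Fin J.r) : Prop := 1 ≤ |J.eig ℓ|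

/-- The upper triangular Jordan miniblock of size `n` with eigenvalue `a`. -/
def miniblock (a : ℝ) (n : ℕ) : Matrix (Fin n) (Fin n) ℝ :=
  Matrix.of fun s s' => if s = s' then a else if (s : ℕ) + 1 = (s' : ℕ) then 1 else 0

/-- The matrix in Jordan form. -/
def A : Matrix J.State J.State ℝ :=
  Matrix.blockDiagonal' fun b : J.Mini => miniblock (J.eig b.1) (J.size b)

end JordanStructure

/-- The system `x(t+1) = A x(t) + B u(t)` with `A` in Jordan form, measured by `N` sensors
`y_i(t) = C_i x(t)`. -/
structure SensorSystem (J : JordanStructure) (N m : ℕ) where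
  B : Matrix J.State (Fin m) ℝ
  p : Fin N → ℕ
  C : (i : Fin N) → Matrix (Fin (p i)) J.State ℝ

/-- A real square matrix is Schur if all its (complex) eigenvalues have modulus less than one. -/
def IsSchur {n : Type*} [Fintype n] [DecidableEq n] (M : Matrix n n ℝ) : Prop :=
  ∀ μ ∈ spectrum ℂ (M.map (algebraMap ℝ ℂ)), ‖μ‖ < 1

/-- The pair `(A, C)` is detectable (in discrete time). -/
def IsDetectable {n q : Type*} [Fintype n] [DecidableEq n] [Fintype q]
    (A : Matrix n n ℝ) (C : Matrix q n ℝ) : Prop :=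
  ∃ L : Matrix n q ℝ, IsSchur (A - L * C)

/-- The index, counted from `1`, of the first nonzero column of a nonzero matrix. -/
def firstNonzeroCol {q n : ℕ} (M : Matrix (Fin q) (Fin n) ℝ) : ℕ :=
  sInf {t : ℕ | ∃ s : Fin n, (s : ℕ) + 1 = t ∧ ∃ a, M a s ≠ 0}

/-- The `t`-th canonical vector, `t` being counted from `1`. -/
def canonicalVec (n t : ℕ) : Fin n → ℝ := fun s => if (s : ℕ) + 1 = t then 1 else 0

namespace SensorSystem

variable {J : JordanStructure} {N m : ℕ} (S : SensorSystem J N m)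

/-- The stacked output matrix `col {C_i}`. -/
def stackedC : Matrix (Σ i : Fin N, Fin (S.p i)) J.State ℝ :=
  Matrix.of fun a => S.C a.1 a.2

/-- The block of `C_i` that corresponds to the miniblock `b`. -/
def blockC (i : Fin N) (b : J.Mini) : Matrix (Fin (S.p i)) (Fin (J.size b)) ℝ :=
  Matrix.of fun a s => S.C i a ⟨b, s⟩

/-- The index (from `1`) of the first nonzero column of the block of `C_i` of the miniblock `b`;
used only if that block is nonzero. -/
def t (i : Fin N) (b : J.Mini) : ℕ := firstNonzeroCol (S.blockC i b)

/-- Agents for which the miniblock `b` is completely unobservable. -/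
def V₁ (b : J.Mini) : Finset (Fin N) :=
  open scoped Classical in Finset.univ.filter fun i => S.blockC i b = 0

/-- Agents for which the miniblock `b` is partly observable. -/
def V₂ (b : J.Mini) : Finset (Fin N) :=
  open scoped Classical in Finset.univ.filter fun i => S.blockC i b ≠ 0 ∧ 1 < S.t i b

/-- Agents for which the miniblock `b` is completely observable. -/
def V₃ (b : J.Mini) : Finset (Fin N) :=
  open scoped Classical in Finset.univ.filter fun i => S.blockC i b ≠ 0 ∧ S.t i b = 1

/-- The agents are jointly detectable. -/
def JointlyDetectable : Prop := IsDetectable J.A S.stackedC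

/-- For every agent `i` and every unstable eigenvalue, the first nonzero columns of the nonzero
blocks of `C_i` that correspond to the miniblocks of this eigenvalue are linearly independent. -/
def IndependentFirstColumns : Prop :=
  ∀ (i : Fin N) (ℓ : Fin J.r), J.Unstable ℓ →
    LinearIndependent ℝ
      (fun h : {h : Fin (J.g ℓ) // i ∈ S.V₂ ⟨ℓ, h⟩ ∪ S.V₃ ⟨ℓ, h⟩} =>
        (S.blockC i ⟨ℓ, h.1⟩).mulVec
          (canonicalVec (J.size ⟨ℓ, h.1⟩) (S.t i ⟨ℓ, h.1⟩)))

/-- The number of (leading) entries of the block `b` of the state that are not observable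
for agent `i`: all, the first `t - 1`, or none. -/
def undetDim (i : Fin N) (b : J.Mini) : ℕ :=
  if i ∈ S.V₁ b then J.size b else if i ∈ S.V₂ b then S.t i b - 1 else 0

/-- The entries of the state that make up the part `z_{i,u}`, undetectable for agent `i`. The
remaining ones, which include all those of stable eigenvalues, make up `z_{i,d}`. -/
def U (i : Fin N) : Finset J.State :=
  open scoped Classical in
    Finset.univ.filter fun x => J.Unstable x.1.1 ∧ (x.2 : ℕ) < S.undetDim i x.1

/-- Indices of `z_{i,u}`. -/
abbrev UIdx (i : Fin N) : Type := {x : J.State // x ∈ S.U i}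

/-- Indices of `z_{i,d}`. -/
abbrev DIdx (i : Fin N) : Type := {x : J.State // x ∉ S.U i}

/-- The permutation matrix with `x = Q_i [z_{i,u}; z_{i,d}]`. -/
def Q (i : Fin N) : Matrix J.State (S.UIdx i ⊕ S.DIdx i) ℝ :=
  (1 : Matrix J.State J.State ℝ).submatrix id (Equiv.sumCompl fun x => x ∈ S.U i)

/-- `Q_iᵀ A Q_i`, of block form `[F_{i,u}, F_{i,*}; 0, F_{i,d}]`. -/
def permA (i : Fin N) : Matrix (S.UIdx i ⊕ S.DIdx i) (S.UIdx i ⊕ S.DIdx i) ℝ :=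
  (S.Q i).transpose * J.A * S.Q i

def Fu (i : Fin N) : Matrix (S.UIdx i) (S.UIdx i) ℝ := (S.permA i).toBlocks₁₁

def Fstar (i : Fin N) : Matrix (S.UIdx i) (S.DIdx i) ℝ := (S.permA i).toBlocks₁₂

def Fd (i : Fin N) : Matrix (S.DIdx i) (S.DIdx i) ℝ := (S.permA i).toBlocks₂₂

/-- `C_i Q_i = [0, H_{i,d}]`. -/
def Hd (i : Fin N) : Matrix (Fin (S.p i)) (S.DIdx i) ℝ := (S.C i * S.Q i).toCols₂

/-- `Q_iᵀ B = [G_{i,u}; G_{i,d}]`. -/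
def Gu (i : Fin N) : Matrix (S.UIdx i) (Fin m) ℝ := ((S.Q i).transpose * S.B).toRows₁

def Gd (i : Fin N) : Matrix (S.DIdx i) (Fin m) ℝ := ((S.Q i).transpose * S.B).toRows₂

/-- The gain matrix `K_i`: the scalar `k b` times an identity on the undetectable part of each
miniblock `b`. -/
def K (k : J.Mini → ℝ) (i : Fin N) : Matrix (S.UIdx i) (S.UIdx i) ℝ :=
  Matrix.diagonal fun x => k x.1.1

/-- The state estimate of agent `i` assembled from its two parts. -/
def assemble (i : Fin N) (zu : S.UIdx i → ℝ) (zd : S.DIdx i → ℝ) : J.State → ℝ :=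
  (S.Q i).mulVec (Sum.elim zu zd)

/-- `u`, `x`, `zu`, `zd` is a joint evolution of the system and of the observers of all the agents:
`x` follows the system with input `u`, the estimates `zd i` of `z_{i,d}` follow the Luenberger
observers with gains `L i`, and the estimates `zu i` of `z_{i,u}` follow the consensus observers
with coupling gains `k`. -/
structure IsEvolution (G : WeightedDigraph N)
    (L : (i : Fin N) → Matrix (S.DIdx i) (Fin (S.p i)) ℝ) (k : J.Mini → ℝ)
    (u : ℕ → Fin m → ℝ) (x : ℕ → J.State → ℝ)
    (zu : (i : Fin N) → ℕ → S.UIdx i → ℝ) (zd : (i : Fin N) → ℕ → S.DIdx i → ℝ) : Prop where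
  state : ∀ τ, x (τ + 1) = J.A.mulVec (x τ) + S.B.mulVec (u τ)
  luenberger : ∀ i τ, zd i (τ + 1) =
    (S.Fd i).mulVec (zd i τ) + (S.Gd i).mulVec (u τ)
      + (L i).mulVec ((S.C i).mulVec (x τ) - (S.Hd i).mulVec (zd i τ))
  consensus : ∀ i τ, zu i (τ + 1) =
    (S.Fu i).mulVec (zu i τ) + (S.Fstar i).mulVec (zd i τ) + (S.Gu i).mulVec (u τ)
      + (S.K k i * S.Fu i).mulVec (∑ j ∈ G.neighbors i, G.adj i j •
          (Matrix.fromCols (1 : Matrix (S.UIdx i) (S.UIdx i) ℝ)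
              (0 : Matrix (S.UIdx i) (S.DIdx i) ℝ) * (S.Q i).transpose).mulVec
            (S.assemble j (zu j τ) (zd j τ) - S.assemble i (zu i τ) (zd i τ)))

/-- With the gains `L` and `k` the observers estimate the state asymptotically: for all inputs,
all initial states and all initial estimates, every estimation error tends to zero. -/
def IsDistributedObserver (G : WeightedDigraph N)
    (L : (i : Fin N) → Matrix (S.DIdx i) (Fin (S.p i)) ℝ) (k : J.Mini → ℝ) : Prop :=
  ∀ u x zu zd, S.IsEvolution G L k u x zu zd →
    ∀ i, Tendsto (fun τ => x τ - S.assemble i (zu i τ) (zd i τ)) atTop (𝓝 0)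

/-- The Laplacian with the rows and columns indexed in `V₃ b` deleted. -/
def reducedLaplacian (G : WeightedDigraph N) (b : J.Mini) :
    Matrix {i : Fin N // i ∉ S.V₃ b} {i : Fin N // i ∉ S.V₃ b} ℝ :=
  G.laplacian.submatrix Subtype.val Subtype.val

/-- The selection matrix of one agent: `I` if the miniblock is completely unobservable for it, and
`[I 0]` with `t - 1` rows if it is partly observable. -/
def selAgent (i : Fin N) (b : J.Mini) :
    Matrix (Fin (S.undetDim i b)) (Fin (J.size b)) ℝ :=
  Matrix.of fun a s => if (a : ℕ) = (s : ℕ) then 1 else 0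

/-- The block diagonal matrix of the selection matrices of the agents in `V₁ ∪ V₂`, that is, of
those outside `V₃`. -/
def sel (b : J.Mini) :
    Matrix (Σ i : {i : Fin N // i ∉ S.V₃ b}, Fin (S.undetDim i.1 b))
      ({i : Fin N // i ∉ S.V₃ b} × Fin (J.size b)) ℝ :=
  (Matrix.blockDiagonal' fun i : {i : Fin N // i ∉ S.V₃ b} => S.selAgent i.1 b).submatrix id
    (Equiv.sigmaEquivProd {i : Fin N // i ∉ S.V₃ b} (Fin (J.size b))).symm

/-- The matrix `S (𝓛 ⊗ I) Sᵀ` of the miniblock `b`. -/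
def couplingMatrix (G : WeightedDigraph N) (b : J.Mini) :
    Matrix (Σ i : {i : Fin N // i ∉ S.V₃ b}, Fin (S.undetDim i.1 b))
      (Σ i : {i : Fin N // i ∉ S.V₃ b}, Fin (S.undetDim i.1 b)) ℝ :=
  S.sel b * (S.reducedLaplacian G b ⊗ₖ (1 : Matrix (Fin (J.size b)) (Fin (J.size b)) ℝ))
    * (S.sel b).transpose

end SensorSystem

end DistributedObserver

end

/-!
The joint estimation error `e = (x - x̂_i)_i` obeys an autonomous recursion `e(t+1) = M e(t)`
(`IsEvolution.error_eq`), and every initial value of `e` occurs, so the gains form a distributed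
observer if and only if `M` is Schur (`isDistributedObserver_iff_isSchur`).

The matrix `M` is block triangular (`errorMatrix_blockTriangular`) once its indices are grouped as
follows: for each entry `x` of an unstable miniblock `b`, the errors at `x` of all the agents that
cannot detect `x`; and for each agent, all its detectable entries. A miniblock couples an entry only
to itself, with factor `λ_b`, and to the next one, so the diagonal block of the entry `x` is
`λ_b (1 - k_b 𝓛_x)`, where `𝓛_x` is the Laplacian restricted to the agents that cannot detect `x`;
the diagonal block of agent `i` is `F_{i,d} - L_i H_{i,d}`. In the same way the coupling matrix
`S (𝓛 ⊗ I) Sᵀ` of `b` is block diagonal with blocks `𝓛_x`, `x` running over the entries of `b`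
(`mem_spectrum_couplingMatrix`). Hence the spectrum of `M` consists of the numbers `λ_b (1 - k_b μ)`
with `μ` in the spectrum of the coupling matrix of an unstable `b`, and of the spectra of the
`F_{i,d} - L_i H_{i,d}` (`mem_spectrum_errorMatrix`). This yields necessity of the condition, and
sufficiency provided that all pairs `(F_{i,d}, H_{i,d})` are detectable.

For detectability, the independence of the first nonzero columns says that no eigenvector of an
unstable eigenvalue of `F_{i,d}` is annihilated by `H_{i,d}` (`eq_zero_of_Fd_mulVec_eq_smul`). As the
eigenvalues of `F_{i,d}` are real, the unstable ones can be moved to `0` one at a time by rank-one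
output injections (`isDetectable_of_forall_eigenvector`), by Brauer's theorem on rank-one
perturbations (`charpoly_sub_vecMulVec`).
-/

noncomputable section

namespace DistributedObserver

open Matrix

/-! ### Spectra and powers of real matrices -/

section LinearAlgebra

open Polynomial

lemma mem_spectrum_iff_of_blockTriangular {n α : Type*} [Fintype n] [DecidableEq n]
    [LinearOrder α] {M : Matrix n n ℝ} {β : n → α} (hM : M.BlockTriangular β) (μ : ℂ) :
    μ ∈ spectrum ℂ (M.map (algebraMap ℝ ℂ)) ↔
      ∃ a, μ ∈ spectrum ℂ ((M.toSquareBlock β a).map (algebraMap ℝ ℂ)) := by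
  simp only [mem_spectrum_iff_isRoot_charpoly, charpoly_map, hM.charpoly, Polynomial.map_prod,
    IsRoot.def, eval_prod, Finset.prod_eq_zero_iff, Finset.mem_image, Finset.mem_univ, true_and]
  constructor
  · rintro ⟨a, -, h⟩
    exact ⟨a, h⟩
  · rintro ⟨a, h⟩
    refine ⟨a, ?_, h⟩
    by_contra hne
    have : IsEmpty {i // β i = a} := ⟨fun i => hne ⟨i.1, i.2⟩⟩
    simp [Matrix.charpoly, Matrix.det_isEmpty] at h

lemma spectrum_map_reindex {n k : Type*} [Fintype n] [DecidableEq n] [Fintype k] [DecidableEq k]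
    (e : n ≃ k) (M : Matrix n n ℝ) :
    spectrum ℂ ((Matrix.reindex e e M).map (algebraMap ℝ ℂ)) =
      spectrum ℂ (M.map (algebraMap ℝ ℂ)) := by
  ext μ
  simp only [mem_spectrum_iff_isRoot_charpoly, charpoly_map, charpoly_reindex]

lemma map_mulVec_ofReal {n : Type*} [Fintype n] [DecidableEq n] (M : Matrix n n ℝ) (v : n → ℝ)
    (t : ℕ) : (M.map (algebraMap ℝ ℂ) ^ t).mulVec (fun i => (v i : ℂ)) =
      fun i => (((M ^ t).mulVec v i : ℝ) : ℂ) := by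
  have h : M.map (algebraMap ℝ ℂ) ^ t = (M ^ t).map (algebraMap ℝ ℂ) :=
    (map_pow (algebraMap ℝ ℂ).mapMatrix M t).symm
  rw [h]
  funext i
  exact (RingHom.map_mulVec (algebraMap ℝ ℂ) (M ^ t) v i).symm

section Powers

attribute [local instance] Matrix.linftyOpNormedRing Matrix.linftyOpNormedAlgebra

/-- Gelfand's formula, with the operator norm induced by the sup norm on vectors. -/
lemma tendsto_norm_pow_of_spectrum {n : Type*} [Fintype n] [DecidableEq n] (M : Matrix n n ℂ)
    (hM : ∀ μ ∈ spectrum ℂ M, ‖μ‖ < 1) : Tendsto (fun t : ℕ => ‖M ^ t‖) atTop (𝓝 0) := by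
  cases isEmpty_or_nonempty n
  · have : ∀ t : ℕ, ‖M ^ t‖ = 0 := fun t => by
      rw [norm_eq_zero]; exact Subsingleton.elim _ _
    simp [this]
  have hlt : spectralRadius ℂ M < ((1 : NNReal) : ENNReal) :=
    spectrum.spectralRadius_lt_of_forall_lt M fun z hz => by
      simpa [← NNReal.coe_lt_coe] using hM z hz
  obtain ⟨q, hq, hq1⟩ := ENNReal.lt_iff_exists_nnreal_btwn.1 hlt
  have hq1' : (q : ℝ) < 1 := by exact_mod_cast hq1
  have hev := (spectrum.pow_nnnorm_pow_one_div_tendsto_nhds_spectralRadius M).eventually_lt_const hq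
  refine squeeze_zero' (Eventually.of_forall fun _ => norm_nonneg _) ?_
    (tendsto_pow_atTop_nhds_zero_of_lt_one q.2 hq1')
  filter_upwards [hev, eventually_gt_atTop 0] with t ht ht0
  have h1 : ((‖M ^ t‖₊ : ENNReal) ^ (1 / t : ℝ)) ^ (t : ℝ) ≤ (q : ENNReal) ^ (t : ℝ) :=
    ENNReal.rpow_le_rpow ht.le (by positivity)
  rw [← ENNReal.rpow_mul, one_div_mul_cancel (by positivity), ENNReal.rpow_one,
    ENNReal.rpow_natCast] at h1
  exact_mod_cast h1

lemma IsSchur.tendsto_pow_mulVec {n : Type*} [Fintype n] [DecidableEq n] {M : Matrix n n ℝ}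
    (hM : IsSchur M) (v : n → ℝ) : Tendsto (fun t : ℕ => (M ^ t).mulVec v) atTop (𝓝 0) := by
  have h := (tendsto_norm_pow_of_spectrum _ hM).mul_const ‖fun i => (v i : ℂ)‖
  rw [zero_mul] at h
  refine squeeze_zero_norm (fun t => ?_) h
  refine le_trans ?_ (linfty_opNorm_mulVec _ _)
  rw [map_mulVec_ofReal]
  refine (pi_norm_le_iff_of_nonneg (norm_nonneg _)).2 fun i => ?_
  have := norm_le_pi_norm (fun i => (((M ^ t).mulVec v i : ℝ) : ℂ)) i
  rwa [Complex.norm_real] at this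

end Powers

/-- The real powers determine the complex ones, so a complex eigenvector `w` of eigenvalue `μ` gives
`μ ^ t • w → 0`. -/
lemma isSchur_of_tendsto_pow_mulVec {n : Type*} [Fintype n] [DecidableEq n] {M : Matrix n n ℝ}
    (hM : ∀ v : n → ℝ, Tendsto (fun t : ℕ => (M ^ t).mulVec v) atTop (𝓝 0)) : IsSchur M := by
  intro μ hμ
  rw [← spectrum_toLin', ← Module.End.hasEigenvalue_iff_mem_spectrum] at hμ
  obtain ⟨w, hw⟩ := hμ.exists_hasEigenvector
  have hpow : ∀ t : ℕ, (M.map (algebraMap ℝ ℂ) ^ t).mulVec w = μ ^ t • w := fun t => by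
    rw [← hw.pow_apply t, ← toLin'_pow, toLin'_apply]
  obtain ⟨i, hi⟩ := Function.ne_iff.1 hw.2
  have hsplit : w = (fun j => ((w j).re : ℂ)) + Complex.I • fun j => ((w j).im : ℂ) := by
    funext j
    simp [mul_comm Complex.I, Complex.re_add_im]
  have hcoord : ∀ v : n → ℝ, Tendsto (fun t : ℕ => (((M ^ t).mulVec v i : ℝ) : ℂ)) atTop (𝓝 0) := by
    intro v
    have h := (Complex.continuous_ofReal.tendsto 0).comp ((tendsto_pi_nhds.1 (hM v)) i)
    simpa [Function.comp_def] using h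
  have hlim : Tendsto (fun t : ℕ => μ ^ t * w i) atTop (𝓝 0) := by
    have h := (hcoord fun j => (w j).re).add ((hcoord fun j => (w j).im).const_mul Complex.I)
    simp only [mul_zero, add_zero] at h
    refine h.congr fun t => ?_
    have := congrFun (hpow t) i
    rw [hsplit, mulVec_add, mulVec_smul, map_mulVec_ofReal, map_mulVec_ofReal, ← hsplit] at this
    simpa using this
  have h0 : Tendsto (fun t : ℕ => μ ^ t) atTop (𝓝 0) := by
    have := hlim.mul_const (w i)⁻¹
    simpa [mul_assoc, mul_inv_cancel₀ hi] using this
  exact tendsto_pow_atTop_nhds_zero_iff_norm_lt_one.1 h0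

/-! ### Stabilization by output injection -/

/-- Brauer's theorem: subtracting `v wᵀ`, where `v` is an eigenvector of `M` for the eigenvalue `a`,
moves this eigenvalue to `a - v ⬝ᵥ w` and keeps all the others, with multiplicities. The proof takes
determinants in `(X - M) ((X - a) + v wᵀ) = (X - a) (X - M + v wᵀ)`. -/
lemma charpoly_sub_vecMulVec {n : Type*} [Fintype n] [DecidableEq n] (M : Matrix n n ℝ)
    (v w : n → ℝ) (a : ℝ) (hv : M.mulVec v = a • v) (hv0 : v ≠ 0) :
    (X - C a) * (M - vecMulVec v w).charpoly = (X - C (a - v ⬝ᵥ w)) * M.charpoly := by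
  have hne : Nonempty n := by
    obtain ⟨i, -⟩ := Function.ne_iff.1 hv0
    exact ⟨i⟩
  set R : Matrix n n ℝ[X] := (vecMulVec v w).map C with hR
  have hMR : M.map C * R = C a • R := by
    rw [hR, ← Matrix.map_mul, mul_vecMulVec, hv]
    ext i j : 1
    simp [vecMulVec_apply]
  have hkey : charmatrix M * ((X - C a) • (1 : Matrix n n ℝ[X]) + R) =
      (X - C a) • charmatrix (M - vecMulVec v w) := by
    have h1 : charmatrix M = (X : ℝ[X]) • (1 : Matrix n n ℝ[X]) - M.map C := by
      ext i j : 1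
      simp [charmatrix_apply, Matrix.one_apply, diagonal_apply]
    have h2 : charmatrix (M - vecMulVec v w) =
        (X : ℝ[X]) • (1 : Matrix n n ℝ[X]) - M.map C + R := by
      ext i j : 1
      simp [charmatrix_apply, Matrix.one_apply, diagonal_apply, hR, vecMulVec_apply]
      ring
    rw [h1, h2, mul_add, sub_mul _ _ R, hMR, mul_smul_comm, mul_one, smul_mul_assoc, one_mul,
      smul_add, sub_smul X (C a) R]
  have hrank : ((X - C a) • (1 : Matrix n n ℝ[X]) + R).det =
      (X - C a) ^ (Fintype.card n - 1) * (X - C (a - v ⬝ᵥ w)) := by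
    have h1 : (X - C a) • (1 : Matrix n n ℝ[X]) + R =
        (X - C a) • (1 : Matrix n n ℝ[X]) + vecMulVec (fun i => C (v i)) (fun i => C (w i)) := by
      congr 1
      ext i j : 1
      simp [hR, vecMulVec_apply]
    have h2 := congrArg (eval (X - C a)) (charpoly_vecMulVec (fun i => C (v i))
      (fun i => -C (w i)))
    have h3 : (fun i => C (v i)) ⬝ᵥ (fun i => -C (w i)) = -C (v ⬝ᵥ w) := by
      simp [dotProduct, map_sum]
    rw [eval_charpoly, h3] at h2
    have h4 : scalar n (X - C a) - vecMulVec (fun i => C (v i)) (fun i => -C (w i)) =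
        (X - C a) • (1 : Matrix n n ℝ[X]) + R := by
      rw [h1]
      ext i j : 1
      simp [vecMulVec_apply, Matrix.one_apply, diagonal_apply]
    rw [h4] at h2
    rw [h2]
    obtain ⟨k, hk⟩ := Nat.exists_eq_succ_of_ne_zero (Fintype.card_ne_zero (α := n))
    simp [hk, pow_succ]
    ring
  have hdet := congrArg Matrix.det hkey
  rw [det_mul, hrank, det_smul] at hdet
  obtain ⟨k, hk⟩ := Nat.exists_eq_succ_of_ne_zero (Fintype.card_ne_zero (α := n))
  rw [hk, Nat.succ_sub_one, pow_succ] at hdet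
  have hX : (X - C a : ℝ[X]) ^ k ≠ 0 := pow_ne_zero _ (X_sub_C_ne_zero a)
  apply mul_left_cancel₀ hX
  simp only [Matrix.charpoly]
  linear_combination -hdet

/-- The Hautus test for detectability, for a matrix whose eigenvalues are all real: if no eigenvector
of an unstable eigenvalue is annihilated by `H`, then `F - L H` is Schur for some `L`. Induction on
the number of unstable eigenvalues: by Brauer's theorem one of them can be moved to `0` by an output
injection, and output injection does not change the eigenvectors annihilated by `H`. -/
lemma isDetectable_of_forall_eigenvector {n q : Type*} [Fintype n] [DecidableEq n] [Fintype q]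
    (H : Matrix q n ℝ) (F : Matrix n n ℝ) (hF : F.charpoly.Splits)
    (hH : ∀ (a : ℝ) (v : n → ℝ), 1 ≤ |a| → F.mulVec v = a • v → H.mulVec v = 0 → v = 0) :
    IsDetectable F H := by
  induction hc : F.charpoly.roots.countP (fun a => 1 ≤ |a|) generalizing F with
  | zero =>
    refine ⟨0, fun μ hμ => ?_⟩
    rw [Matrix.zero_mul, sub_zero, mem_spectrum_iff_isRoot_charpoly, charpoly_map] at hμ
    obtain ⟨a, rfl⟩ := hF.mem_range_of_isRoot (F.charpoly_monic.ne_zero) hμ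
    have ha : a ∈ F.charpoly.roots := by
      rw [mem_roots F.charpoly_monic.ne_zero]
      exact hμ.of_map (algebraMap ℝ ℂ).injective
    have := Multiset.countP_eq_zero.1 hc a ha
    simpa using this
  | succ c ih =>
    obtain ⟨a, haF, ha⟩ := Multiset.countP_pos.1 (by rw [hc]; exact Nat.succ_pos c)
    have hroot : F.charpoly.IsRoot a := (mem_roots F.charpoly_monic.ne_zero).1 haF
    rw [← mem_spectrum_iff_isRoot_charpoly, ← spectrum_toLin',
      ← Module.End.hasEigenvalue_iff_mem_spectrum] at hroot
    obtain ⟨v, hv⟩ := hroot.exists_hasEigenvector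
    have hv1 : F.mulVec v = a • v := by simpa using hv.apply_eq_smul
    have hHv : H.mulVec v ≠ 0 := fun h => hv.2 (hH a v ha hv1 h)
    have hpos : H.mulVec v ⬝ᵥ H.mulVec v ≠ 0 := fun h => hHv (dotProduct_self_eq_zero.1 h)
    -- The injection `v gᵀ` moves the eigenvalue `a` to `a - gᵀ H v = 0`.
    set g : q → ℝ := (a / (H.mulVec v ⬝ᵥ H.mulVec v)) • H.mulVec v with hg
    have hLH : vecMulVec v g * H = vecMulVec v (g ᵥ* H) := vecMulVec_mul _ _ _
    have hvg : v ⬝ᵥ (g ᵥ* H) = a := by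
      rw [dotProduct_comm, ← dotProduct_mulVec, hg, smul_dotProduct, smul_eq_mul,
        div_mul_cancel₀ _ hpos]
    have hchar := charpoly_sub_vecMulVec F v (g ᵥ* H) a hv1 hv.2
    rw [hvg, sub_self, C_0, sub_zero] at hchar
    set F' := F - vecMulVec v (g ᵥ* H) with hF'
    have hsp : F'.charpoly.Splits := by
      rw [← splits_X_sub_C_mul_iff (a := a), hchar]
      exact splits_X_mul.2 hF
    have hroots := congrArg Polynomial.roots hchar
    rw [roots_mul (mul_ne_zero (X_sub_C_ne_zero a) F'.charpoly_monic.ne_zero),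
      roots_mul (mul_ne_zero X_ne_zero F.charpoly_monic.ne_zero), roots_X, roots_X_sub_C] at hroots
    have hcount := congrArg (Multiset.countP (fun a : ℝ => 1 ≤ |a|)) hroots
    rw [Multiset.countP_add, Multiset.countP_add, hc] at hcount
    have h0 : Multiset.countP (fun a : ℝ => 1 ≤ |a|) {0} = 0 := by
      rw [Multiset.countP_eq_zero]; simp
    have h1 : Multiset.countP (fun a : ℝ => 1 ≤ |a|) {a} = 1 := by
      rw [← Multiset.cons_zero, Multiset.countP_cons_of_pos (p := fun a : ℝ => 1 ≤ |a|) _ ha,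
        Multiset.countP_zero]
    rw [h0, h1] at hcount
    obtain ⟨L, hL⟩ := ih F' hsp (fun b z hb hz hHz => by
      refine hH b z hb ?_ hHz
      rw [← hz, hF', sub_mulVec, ← hLH, ← mulVec_mulVec, hHz, mulVec_zero, sub_zero]) (by omega)
    refine ⟨vecMulVec v g + L, ?_⟩
    rwa [Matrix.add_mul, hLH, ← sub_sub]

lemma splits_charpoly_of_blockTriangular_injective {n α : Type*} [Fintype n] [DecidableEq n]
    [LinearOrder α] {M : Matrix n n ℝ} {β : n → α} (hM : M.BlockTriangular β)
    (hβ : Function.Injective β) : M.charpoly.Splits := by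
  rw [hM.charpoly]
  refine Splits.prod fun a _ => Splits.of_natDegree_le_one ?_
  rw [charpoly_natDegree_eq_dim]
  exact Fintype.card_le_one_iff.2 fun i j => Subtype.ext (hβ (i.2.trans j.2.symm))

end LinearAlgebra

/-- Spectral mapping for `c (1 - k M)`; it includes `k = 0`, where it relies on the spectrum of a
nonempty complex matrix being nonempty, and the empty matrix. -/
lemma mem_spectrum_smul_one_sub_smul {n : Type*} [Fintype n] [DecidableEq n] (M : Matrix n n ℝ)
    (c k : ℝ) (μ : ℂ) :
    μ ∈ spectrum ℂ ((c • (1 - k • M)).map (algebraMap ℝ ℂ)) ↔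
      ∃ ν ∈ spectrum ℂ (M.map (algebraMap ℝ ℂ)), (c : ℂ) * (1 - k * ν) = μ := by
  cases isEmpty_or_nonempty n
  · simp [spectrum.of_subsingleton]
  have h : (c • (1 - k • M)).map (algebraMap ℝ ℂ) =
      Polynomial.aeval (M.map (algebraMap ℝ ℂ))
        (Polynomial.C (c : ℂ) * (1 - Polynomial.C (k : ℂ) * Polynomial.X)) := by
    simp only [map_mul, map_sub, map_one, Polynomial.aeval_C, Polynomial.aeval_X,
      Algebra.algebraMap_eq_smul_one, smul_mul_assoc, one_mul]
    ext i j
    simp [Matrix.one_apply, apply_ite]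
  rw [h, spectrum.map_polynomial_aeval_of_nonempty _ _
    (spectrum.nonempty_of_isAlgClosed_of_finiteDimensional ℂ _)]
  simp

/-! ### The estimation error follows an autonomous linear recursion -/

namespace JordanStructure

variable (J : JordanStructure)

lemma A_apply_same (b : J.Mini) (s s' : Fin (J.size b)) :
    J.A ⟨b, s⟩ ⟨b, s'⟩ = if s = s' then J.eig b.1 else if (s : ℕ) + 1 = s' then 1 else 0 := by
  simp [A, miniblock]

lemma A_apply_of_ne {x y : J.State} (h : x.1 ≠ y.1) : J.A x y = 0 := by
  rw [A, blockDiagonal'_apply, dif_neg h]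

lemma A_support {x y : J.State} (h : J.A x y ≠ 0) :
    ∃ (b : J.Mini) (s s' : Fin (J.size b)), x = ⟨b, s⟩ ∧ y = ⟨b, s'⟩ ∧
      (s' = s ∨ (s' : ℕ) = s + 1) := by
  obtain ⟨b, s⟩ := x
  obtain ⟨b', s'⟩ := y
  obtain rfl : b = b' := by
    by_contra hb
    exact h (J.A_apply_of_ne hb)
  refine ⟨b, s, s', rfl, rfl, ?_⟩
  rw [A_apply_same] at h
  by_contra! hne
  rw [if_neg hne.1.symm, if_neg hne.2.symm] at h
  exact h rfl

end JordanStructure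

lemma WeightedDigraph.laplacian_sum {N : ℕ} (G : WeightedDigraph N) (i : Fin N) (f : Fin N → ℝ) :
    ∑ j, G.laplacian i j * f j = ∑ j ∈ G.neighbors i, G.adj i j * (f i - f j) := by
  have h : ∑ j ∈ G.neighbors i, G.adj i j * (f i - f j) = ∑ j, G.adj i j * (f i - f j) := by
    refine Finset.sum_subset (Finset.subset_univ _) fun j _ hj => ?_
    have : G.adj i j = 0 := by
      refine le_antisymm ?_ (G.adj_nonneg i j)
      simpa [neighbors] using hj
    rw [this, zero_mul]
  rw [h]
  simp only [laplacian, Matrix.sub_apply, diagonal_apply, sub_mul, mul_sub, ite_mul, zero_mul,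
    Finset.sum_sub_distrib, Finset.sum_ite_eq, Finset.mem_univ, if_true, Finset.sum_mul]

namespace SensorSystem

variable {J : JordanStructure} {N m : ℕ} (S : SensorSystem J N m)

lemma exists_col_t {i : Fin N} {b : J.Mini} (h : S.blockC i b ≠ 0) :
    ∃ s : Fin (J.size b), (s : ℕ) + 1 = S.t i b ∧ ∃ a, S.blockC i b a s ≠ 0 := by
  have hne : {t : ℕ | ∃ s : Fin (J.size b),
      (s : ℕ) + 1 = t ∧ ∃ a, S.blockC i b a s ≠ 0}.Nonempty := by
    obtain ⟨a, ha⟩ := Function.ne_iff.1 h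
    obtain ⟨s, hs⟩ := Function.ne_iff.1 ha
    exact ⟨_, s, rfl, a, hs⟩
  exact Nat.sInf_mem hne

lemma undetDim_of_blockC_eq_zero {i : Fin N} {b : J.Mini} (h : S.blockC i b = 0) :
    S.undetDim i b = J.size b := by
  simp [undetDim, V₁, h]

/-- For agents outside `V₁`, the case distinction in `undetDim` collapses to `t - 1`. -/
lemma undetDim_add_one {i : Fin N} {b : J.Mini} (h : S.blockC i b ≠ 0) :
    S.undetDim i b + 1 = S.t i b := by
  obtain ⟨s, hs, -⟩ := S.exists_col_t h
  by_cases h1 : 1 < S.t i b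
  · simp only [undetDim, V₁, V₂, Finset.mem_filter, Finset.mem_univ, true_and, h, h1, if_false,
      ne_eq, not_false_eq_true, if_true]
    omega
  · simp only [undetDim, V₁, V₂, Finset.mem_filter, Finset.mem_univ, h, h1, if_false,
      ne_eq, not_false_eq_true, and_false]
    omega

lemma undetDim_le (i : Fin N) (b : J.Mini) : S.undetDim i b ≤ J.size b := by
  by_cases h : S.blockC i b = 0
  · exact (S.undetDim_of_blockC_eq_zero h).le
  · obtain ⟨s, hs, -⟩ := S.exists_col_t h
    have := S.undetDim_add_one h
    have := s.2
    omega

lemma notMem_V₃_of_undetDim_pos {i : Fin N} {b : J.Mini} (h : 0 < S.undetDim i b) :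
    i ∉ S.V₃ b := by
  intro hi
  simp only [V₃, Finset.mem_filter, Finset.mem_univ, true_and] at hi
  have := S.undetDim_add_one hi.1
  omega

lemma mem_V₂_union_V₃ {i : Fin N} {b : J.Mini} : i ∈ S.V₂ b ∪ S.V₃ b ↔ S.blockC i b ≠ 0 := by
  simp only [V₂, V₃, Finset.mem_union, Finset.mem_filter, Finset.mem_univ, true_and]
  constructor
  · rintro (h | h) <;> exact h.1
  · intro h
    have := S.undetDim_add_one h
    rcases Nat.lt_or_ge 1 (S.t i b) with h1 | h1
    · exact Or.inl ⟨h, h1⟩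
    · exact Or.inr ⟨h, by omega⟩

lemma C_eq_zero_of_lt_undetDim {i : Fin N} {b : J.Mini} {s : Fin (J.size b)}
    (hs : (s : ℕ) < S.undetDim i b) (a : Fin (S.p i)) : S.C i a ⟨b, s⟩ = 0 := by
  by_cases h : S.blockC i b = 0
  · exact congrFun (congrFun h a) s
  · by_contra hne
    have hle : S.t i b ≤ s + 1 := Nat.sInf_le ⟨s, rfl, a, hne⟩
    have := S.undetDim_add_one h
    omega

lemma mem_U {i : Fin N} {x : J.State} :
    x ∈ S.U i ↔ J.Unstable x.1.1 ∧ (x.2 : ℕ) < S.undetDim i x.1 := by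
  simp [U]

lemma C_eq_zero_of_mem_U {i : Fin N} {x : J.State} (hx : x ∈ S.U i) (a : Fin (S.p i)) :
    S.C i a x = 0 :=
  S.C_eq_zero_of_lt_undetDim (S.mem_U.1 hx).2 a

/-- The undetectable entries span an invariant subspace: the lower left block of `Q_iᵀ A Q_i` is zero. -/
lemma A_eq_zero_of_notMem_of_mem {i : Fin N} {x y : J.State} (hx : x ∉ S.U i) (hy : y ∈ S.U i) :
    J.A x y = 0 := by
  by_contra h
  obtain ⟨b, s, s', rfl, rfl, hs⟩ := J.A_support h
  rw [mem_U] at hx hy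
  refine hx ⟨hy.1, lt_of_le_of_lt ?_ hy.2⟩
  rcases hs with rfl | hs <;> simp_all

lemma Q_apply_inl (i : Fin N) (x : J.State) (y : S.UIdx i) :
    S.Q i x (Sum.inl y) = if x = y.1 then 1 else 0 := by
  simp only [Q, submatrix_apply, id, Equiv.sumCompl_apply_inl, Matrix.one_apply]
  congr

lemma Q_apply_inr (i : Fin N) (x : J.State) (y : S.DIdx i) :
    S.Q i x (Sum.inr y) = if x = y.1 then 1 else 0 := by
  simp only [Q, submatrix_apply, id, Equiv.sumCompl_apply_inr, Matrix.one_apply]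
  congr

lemma Fu_apply (i : Fin N) (x y : S.UIdx i) : S.Fu i x y = J.A x y := by
  simp [Fu, permA, toBlocks₁₁, mul_apply, Q_apply_inl]

lemma Fstar_apply (i : Fin N) (x : S.UIdx i) (y : S.DIdx i) : S.Fstar i x y = J.A x y := by
  simp [Fstar, permA, toBlocks₁₂, mul_apply, Q_apply_inl, Q_apply_inr]

lemma Fd_apply (i : Fin N) (x y : S.DIdx i) : S.Fd i x y = J.A x y := by
  simp [Fd, permA, toBlocks₂₂, mul_apply, Q_apply_inr]

lemma Hd_apply (i : Fin N) (a : Fin (S.p i)) (y : S.DIdx i) : S.Hd i a y = S.C i a y := by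
  simp [Hd, toCols₂, mul_apply, Q_apply_inr]

lemma Gu_apply (i : Fin N) (x : S.UIdx i) (c : Fin m) : S.Gu i x c = S.B x c := by
  simp [Gu, toRows₁, mul_apply, Q_apply_inl]

lemma Gd_apply (i : Fin N) (x : S.DIdx i) (c : Fin m) : S.Gd i x c = S.B x c := by
  simp [Gd, toRows₂, mul_apply, Q_apply_inr]

lemma selection_mulVec (i : Fin N) (w : J.State → ℝ) (x : S.UIdx i) :
    (Matrix.fromCols (1 : Matrix (S.UIdx i) (S.UIdx i) ℝ)
      (0 : Matrix (S.UIdx i) (S.DIdx i) ℝ) * (S.Q i).transpose).mulVec w x = w x := by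
  have h : ∀ y, (Matrix.fromCols (1 : Matrix (S.UIdx i) (S.UIdx i) ℝ)
      (0 : Matrix (S.UIdx i) (S.DIdx i) ℝ) * (S.Q i).transpose) x y = if y = x.1 then 1 else 0 := by
    intro y
    rw [mul_apply, Fintype.sum_eq_single (Sum.inl x)]
    · simp [Q_apply_inl]
    · rintro (z | z) hz
      · have hxz : x ≠ z := fun h => hz (h ▸ rfl)
        rw [fromCols_apply_inl, Matrix.one_apply_ne hxz, zero_mul]
      · simp
  simp [mulVec, dotProduct, h]

lemma assemble_apply_mem (i : Fin N) (zu : S.UIdx i → ℝ) (zd : S.DIdx i → ℝ) (x : S.UIdx i) :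
    S.assemble i zu zd x = zu x := by
  have h : ∀ y : S.DIdx i, ¬ (x : J.State) = y := fun y hxy => y.2 (hxy ▸ x.2)
  simp [assemble, mulVec, dotProduct, Q_apply_inl, Q_apply_inr, h]

lemma assemble_apply_notMem (i : Fin N) (zu : S.UIdx i → ℝ) (zd : S.DIdx i → ℝ) (x : S.DIdx i) :
    S.assemble i zu zd x = zd x := by
  have h : ∀ y : S.UIdx i, ¬ (x : J.State) = y := fun y hxy => x.2 (hxy ▸ y.2)
  simp [assemble, mulVec, dotProduct, Q_apply_inl, Q_apply_inr, h, ← Subtype.ext_iff]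

lemma sum_state (i : Fin N) (f : J.State → ℝ) :
    ∑ x, f x = ∑ x : S.UIdx i, f x + ∑ x : S.DIdx i, f x := by
  rw [← Fintype.sum_sumElim, ← (Equiv.sumCompl fun x => x ∈ S.U i).sum_comp]
  refine Finset.sum_congr rfl ?_
  rintro (x | x) - <;> simp

/-- The matrix of the dynamics of the joint estimation error `(e_i)_i`, `e_i = x - x̂_i`, in the
original coordinates of the state. The row of an undetectable entry carries the consensus coupling,
which acts through `F_{i,u}`, hence only on undetectable entries of agent `i`; the row of a detectable
entry carries the output injection `L_i C_i`. -/
def errorMatrix (G : WeightedDigraph N) (L : (i : Fin N) → Matrix (S.DIdx i) (Fin (S.p i)) ℝ)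
    (k : J.Mini → ℝ) : Matrix (Fin N × J.State) (Fin N × J.State) ℝ :=
  Matrix.of fun a c =>
    if h : a.2 ∈ S.U a.1 then
      (if a.1 = c.1 then J.A a.2 c.2 else 0) -
        k a.2.1 * if c.2 ∈ S.U a.1 then J.A a.2 c.2 * G.laplacian a.1 c.1 else 0
    else if a.1 = c.1 then J.A a.2 c.2 - (L a.1 * S.C a.1) ⟨a.2, h⟩ c.2 else 0

variable {S}

lemma errorMatrix_mulVec_mem {G : WeightedDigraph N}
    {L : (i : Fin N) → Matrix (S.DIdx i) (Fin (S.p i)) ℝ}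
    {k : J.Mini → ℝ} (e : Fin N → J.State → ℝ) (i : Fin N) (x : S.UIdx i) :
    (S.errorMatrix G L k).mulVec (fun a => e a.1 a.2) (i, x) =
      J.A.mulVec (e i) x - k x.1.1 * ∑ y : S.UIdx i, J.A x y *
        ∑ j ∈ G.neighbors i, G.adj i j * (e i y - e j y) := by
  have hx : ∀ c : Fin N × J.State, S.errorMatrix G L k (i, x) c =
      (if i = c.1 then J.A x c.2 else 0) -
        k x.1.1 * if c.2 ∈ S.U i then J.A x c.2 * G.laplacian i c.1 else 0 := fun c => by
    rw [errorMatrix, of_apply, dif_pos x.2]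
  simp only [mulVec, dotProduct, hx, sub_mul, Finset.sum_sub_distrib]
  congr 1
  · rw [Fintype.sum_prod_type]
    simp [ite_mul]
  · simp only [mul_assoc, ← Finset.mul_sum]
    congr 1
    rw [Fintype.sum_prod_type_right, S.sum_state i]
    have h0 : ∀ y : S.DIdx i, (∑ j, (if (y : J.State) ∈ S.U i then
        J.A x y * G.laplacian i j else 0) * e j y) = 0 := fun y => by simp [y.2]
    simp only [h0, Finset.sum_const_zero, add_zero]
    refine Finset.sum_congr rfl fun y _ => ?_
    rw [← G.laplacian_sum i fun j => e j y, Finset.mul_sum]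
    exact Finset.sum_congr rfl fun j _ => by rw [if_pos y.2, mul_assoc]

lemma errorMatrix_mulVec_notMem {G : WeightedDigraph N}
    {L : (i : Fin N) → Matrix (S.DIdx i) (Fin (S.p i)) ℝ}
    {k : J.Mini → ℝ} (e : Fin N → J.State → ℝ) (i : Fin N) (x : S.DIdx i) :
    (S.errorMatrix G L k).mulVec (fun a => e a.1 a.2) (i, x) =
      J.A.mulVec (e i) x - (L i).mulVec ((S.C i).mulVec (e i)) x := by
  have hx : ∀ c : Fin N × J.State, S.errorMatrix G L k (i, x) c =
      if i = c.1 then J.A x c.2 - (L i * S.C i) x c.2 else 0 := fun c => by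
    rw [errorMatrix, of_apply, dif_neg x.2]
  rw [mulVec_mulVec]
  simp only [mulVec, dotProduct, hx]
  rw [Fintype.sum_prod_type]
  simp [ite_mul, sub_mul]

lemma IsEvolution.error_succ {G : WeightedDigraph N}
    {L : (i : Fin N) → Matrix (S.DIdx i) (Fin (S.p i)) ℝ} {k : J.Mini → ℝ}
    {u : ℕ → Fin m → ℝ} {x : ℕ → J.State → ℝ}
    {zu : (i : Fin N) → ℕ → S.UIdx i → ℝ} {zd : (i : Fin N) → ℕ → S.DIdx i → ℝ}
    (h : S.IsEvolution G L k u x zu zd) (τ : ℕ) :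
    (fun a : Fin N × J.State =>
        x (τ + 1) a.2 - S.assemble a.1 (zu a.1 (τ + 1)) (zd a.1 (τ + 1)) a.2) =
      (S.errorMatrix G L k).mulVec fun a =>
        x τ a.2 - S.assemble a.1 (zu a.1 τ) (zd a.1 τ) a.2 := by
  funext ⟨i, y⟩
  by_cases hy : y ∈ S.U i
  · lift y to S.UIdx i using hy
    rw [errorMatrix_mulVec_mem (fun j y => x τ y - S.assemble j (zu j τ) (zd j τ) y)]
    have hFu : ∀ w : S.UIdx i → ℝ, (S.Fu i).mulVec w y = ∑ z : S.UIdx i, J.A y z * w z :=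
      fun w => by simp [mulVec, dotProduct, Fu_apply]
    have hFs : (S.Fstar i).mulVec (zd i τ) y = ∑ z : S.DIdx i, J.A y z * zd i τ z := by
      simp [mulVec, dotProduct, Fstar_apply]
    have hGu : (S.Gu i).mulVec (u τ) y = S.B.mulVec (u τ) y := by
      simp [mulVec, dotProduct, Gu_apply]
    have hA : J.A.mulVec (fun z => x τ z - S.assemble i (zu i τ) (zd i τ) z) y =
        J.A.mulVec (x τ) y - ((∑ z : S.UIdx i, J.A y z * zu i τ z) +
          ∑ z : S.DIdx i, J.A y z * zd i τ z) := by
      have : (fun z => x τ z - S.assemble i (zu i τ) (zd i τ) z) =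
        x τ - S.assemble i (zu i τ) (zd i τ) := rfl
      rw [this, mulVec_sub, Pi.sub_apply]
      congr 1
      rw [mulVec, dotProduct, S.sum_state i]
      simp only [assemble_apply_mem, assemble_apply_notMem]
    dsimp only
    rw [assemble_apply_mem, h.state, h.consensus, hA]
    simp only [Pi.add_apply, hFs, hGu, hFu, ← mulVec_mulVec, K, mulVec_diagonal]
    have hsum : ∀ z : S.UIdx i, (∑ j ∈ G.neighbors i, G.adj i j •
          (Matrix.fromCols (1 : Matrix (S.UIdx i) (S.UIdx i) ℝ)
              (0 : Matrix (S.UIdx i) (S.DIdx i) ℝ) * (S.Q i).transpose).mulVec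
            (S.assemble j (zu j τ) (zd j τ) - S.assemble i (zu i τ) (zd i τ))) z =
        ∑ j ∈ G.neighbors i, G.adj i j * (x τ z - S.assemble i (zu i τ) (zd i τ) z -
          (x τ z - S.assemble j (zu j τ) (zd j τ) z)) := by
      intro z
      rw [Finset.sum_apply]
      refine Finset.sum_congr rfl fun j _ => ?_
      rw [Pi.smul_apply, selection_mulVec, Pi.sub_apply, smul_eq_mul]
      ring
    simp only [mulVec_mulVec, hsum]
    ring
  · lift y to S.DIdx i using hy
    rw [errorMatrix_mulVec_notMem (fun j y => x τ y - S.assemble j (zu j τ) (zd j τ) y)]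
    have hFd : (S.Fd i).mulVec (zd i τ) y =
        J.A.mulVec (S.assemble i (zu i τ) (zd i τ)) y := by
      simp only [mulVec, dotProduct]
      rw [S.sum_state i]
      simp only [assemble_apply_mem, assemble_apply_notMem, Fd_apply]
      rw [Finset.sum_eq_zero (s := (Finset.univ : Finset (S.UIdx i))), zero_add]
      intro z _
      rw [S.A_eq_zero_of_notMem_of_mem y.2 z.2, zero_mul]
    have hGd : (S.Gd i).mulVec (u τ) y = S.B.mulVec (u τ) y := by
      simp [mulVec, dotProduct, Gd_apply]
    have hHd : (S.Hd i).mulVec (zd i τ) = (S.C i).mulVec (S.assemble i (zu i τ) (zd i τ)) := by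
      funext a
      simp only [mulVec, dotProduct]
      rw [S.sum_state i]
      simp only [assemble_apply_mem, assemble_apply_notMem, Hd_apply]
      rw [Finset.sum_eq_zero (s := (Finset.univ : Finset (S.UIdx i))), zero_add]
      intro z _
      rw [S.C_eq_zero_of_mem_U z.2, zero_mul]
    have he : (fun z => x τ z - S.assemble i (zu i τ) (zd i τ) z) =
        x τ - S.assemble i (zu i τ) (zd i τ) := rfl
    dsimp only
    rw [assemble_apply_notMem, h.state, h.luenberger, he]
    simp only [mulVec_sub, Pi.add_apply, Pi.sub_apply, hFd, hGd, hHd]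
    ring

lemma IsEvolution.error_eq {G : WeightedDigraph N}
    {L : (i : Fin N) → Matrix (S.DIdx i) (Fin (S.p i)) ℝ} {k : J.Mini → ℝ}
    {u : ℕ → Fin m → ℝ} {x : ℕ → J.State → ℝ}
    {zu : (i : Fin N) → ℕ → S.UIdx i → ℝ} {zd : (i : Fin N) → ℕ → S.DIdx i → ℝ}
    (h : S.IsEvolution G L k u x zu zd) (τ : ℕ) :
    (fun a : Fin N × J.State => x τ a.2 - S.assemble a.1 (zu a.1 τ) (zd a.1 τ) a.2) =
      (S.errorMatrix G L k ^ τ).mulVec fun a =>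
        x 0 a.2 - S.assemble a.1 (zu a.1 0) (zd a.1 0) a.2 := by
  induction τ with
  | zero => simp
  | succ τ ih => rw [h.error_succ, ih, mulVec_mulVec, pow_succ']

/-- Every joint initial error occurs: take `x = 0` and `u = 0`. -/
lemma exists_isEvolution (G : WeightedDigraph N)
    (L : (i : Fin N) → Matrix (S.DIdx i) (Fin (S.p i)) ℝ) (k : J.Mini → ℝ)
    (e : Fin N × J.State → ℝ) :
    ∃ u x zu zd, S.IsEvolution G L k u x zu zd ∧
      (fun a : Fin N × J.State => x 0 a.2 - S.assemble a.1 (zu a.1 0) (zd a.1 0) a.2) = e := by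
  let step : (((i : Fin N) → S.UIdx i → ℝ) × ((i : Fin N) → S.DIdx i → ℝ)) →
      (((i : Fin N) → S.UIdx i → ℝ) × ((i : Fin N) → S.DIdx i → ℝ)) := fun z =>
    (fun i => (S.Fu i).mulVec (z.1 i) + (S.Fstar i).mulVec (z.2 i)
      + (S.K k i * S.Fu i).mulVec (∑ j ∈ G.neighbors i, G.adj i j •
          (Matrix.fromCols (1 : Matrix (S.UIdx i) (S.UIdx i) ℝ)
              (0 : Matrix (S.UIdx i) (S.DIdx i) ℝ) * (S.Q i).transpose).mulVec
            (S.assemble j (z.1 j) (z.2 j) - S.assemble i (z.1 i) (z.2 i))),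
     fun i => (S.Fd i).mulVec (z.2 i) - (L i).mulVec ((S.Hd i).mulVec (z.2 i)))
  let z : ℕ → (((i : Fin N) → S.UIdx i → ℝ) × ((i : Fin N) → S.DIdx i → ℝ)) := fun τ =>
    step^[τ] (fun i y => -e (i, y), fun i y => -e (i, y))
  have hz : ∀ τ, z (τ + 1) = step (z τ) := fun τ => Function.iterate_succ_apply' _ _ _
  refine ⟨fun _ => 0, fun _ => 0, fun i τ => (z τ).1 i, fun i τ => (z τ).2 i, ⟨?_, ?_, ?_⟩, ?_⟩
  · intro τ
    simp
  · intro i τ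
    rw [hz]
    simp [step, sub_eq_add_neg, mulVec_neg]
  · intro i τ
    rw [hz]
    simp only [step, mulVec_zero, add_zero]
  · funext ⟨i, y⟩
    by_cases hy : y ∈ S.U i
    · lift y to S.UIdx i using hy
      simp [assemble_apply_mem, z]
    · lift y to S.DIdx i using hy
      simp [assemble_apply_notMem, z]

theorem isDistributedObserver_iff_isSchur (G : WeightedDigraph N)
    (L : (i : Fin N) → Matrix (S.DIdx i) (Fin (S.p i)) ℝ) (k : J.Mini → ℝ) :
    S.IsDistributedObserver G L k ↔ IsSchur (S.errorMatrix G L k) := by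
  constructor
  · intro h
    refine isSchur_of_tendsto_pow_mulVec fun e => ?_
    obtain ⟨u, x, zu, zd, hev, rfl⟩ := exists_isEvolution (S := S) G L k e
    simp only [← hev.error_eq]
    rw [tendsto_pi_nhds]
    rintro ⟨i, y⟩
    exact tendsto_pi_nhds.1 (h u x zu zd hev i) y
  · intro h u x zu zd hev i
    have := h.tendsto_pow_mulVec fun a : Fin N × J.State =>
      x 0 a.2 - S.assemble a.1 (zu a.1 0) (zd a.1 0) a.2
    simp only [← hev.error_eq] at this
    rw [tendsto_pi_nhds] at this ⊢
    exact fun y => this (i, y)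

end SensorSystem

/-! ### Detectability of the subsystem seen by one agent -/

namespace JordanStructure

variable (J : JordanStructure)

lemma A_mulVec_apply (w : J.State → ℝ) (b : J.Mini) (s : Fin (J.size b)) :
    J.A.mulVec w ⟨b, s⟩ = J.eig b.1 * w ⟨b, s⟩ +
      if h : (s : ℕ) + 1 < J.size b then w ⟨b, ⟨s + 1, h⟩⟩ else 0 := by
  rw [mulVec, dotProduct, Fintype.sum_sigma, Fintype.sum_eq_single b]
  · rw [Fintype.sum_eq_add_sum_compl s, A_apply_same, if_pos rfl]
    congr 1
    have hs : ∀ s' ∈ ({s}ᶜ : Finset (Fin (J.size b))), J.A ⟨b, s⟩ ⟨b, s'⟩ * w ⟨b, s'⟩ =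
        if (s : ℕ) + 1 = s' then w ⟨b, s'⟩ else 0 := by
      intro s' hs'
      rw [A_apply_same, if_neg (fun h => by simp [h] at hs'), ite_mul, one_mul, zero_mul]
    rw [Finset.sum_congr rfl hs]
    split_ifs with h
    · rw [Finset.sum_eq_single ⟨s + 1, h⟩, if_pos rfl]
      · intro s' _ hne
        exact if_neg fun h' => hne (Fin.ext h'.symm)
      · intro hmem
        simp [Fin.ext_iff] at hmem
    · refine Finset.sum_eq_zero fun s' _ => if_neg fun h' => ?_
      have := s'.2
      omega
  · intro b' hb
    exact Finset.sum_eq_zero fun s' _ => by rw [J.A_apply_of_ne (Ne.symm hb), zero_mul]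

/-- The number of a miniblock in an arbitrary enumeration. -/
def miniIndex (b : J.Mini) : ℕ := Fintype.equivFin J.Mini b

lemma miniIndex_injective : Function.Injective J.miniIndex := fun _ _ h =>
  (Fintype.equivFin J.Mini).injective (Fin.ext h)

lemma miniIndex_lt (b : J.Mini) : J.miniIndex b < Fintype.card J.Mini :=
  (Fintype.equivFin J.Mini b).2

/-- The sort key of the entries of the state: by miniblock, then by position. -/
def stateKey (x : J.State) : ℕ ×ₗ ℕ := toLex (J.miniIndex x.1, (x.2 : ℕ))

lemma stateKey_injective : Function.Injective J.stateKey := by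
  rintro ⟨b, s⟩ ⟨b', s'⟩ h
  obtain ⟨h1, h2⟩ := Prod.ext_iff.1 (toLex.injective h)
  obtain rfl := J.miniIndex_injective h1
  obtain rfl := Fin.ext h2
  rfl

lemma stateKey_le_of_A_ne_zero {x y : J.State} (h : J.A x y ≠ 0) :
    J.stateKey x ≤ J.stateKey y := by
  obtain ⟨b, s, s', rfl, rfl, hs⟩ := J.A_support h
  refine Prod.Lex.toLex_le_toLex.2 (Or.inr ⟨rfl, ?_⟩)
  rcases hs with rfl | hs
  · exact le_rfl
  · dsimp only
    omega

/-- The sort key of the detectable entries of agent `i`, larger than all `stateKey`s. -/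
def agentKey {N : ℕ} (i : Fin N) : ℕ ×ₗ ℕ :=
  toLex (Fintype.card J.Mini + i, 0)

lemma agentKey_injective {N : ℕ} : Function.Injective (J.agentKey (N := N)) := fun _ _ h =>
  Fin.ext (Nat.add_left_cancel (Prod.ext_iff.1 (toLex.injective h)).1)

lemma stateKey_lt_agentKey {N : ℕ} (x : J.State) (i : Fin N) : J.stateKey x < J.agentKey i :=
  Prod.Lex.toLex_lt_toLex.2 (Or.inl (Nat.lt_add_right (i : ℕ) (J.miniIndex_lt x.1)))

end JordanStructure

namespace SensorSystem

variable {J : JordanStructure} {N m : ℕ} {S : SensorSystem J N m}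

/-- All eigenvalues of `F_{i,d}` are real, since it is triangular for the order of `stateKey`. -/
lemma splits_charpoly_Fd (i : Fin N) : (S.Fd i).charpoly.Splits := by
  refine splits_charpoly_of_blockTriangular_injective (β := fun x : S.DIdx i => J.stateKey x) ?_
    fun x y h => Subtype.ext (J.stateKey_injective h)
  intro x y hxy
  rw [Fd_apply]
  by_contra h
  exact absurd (J.stateKey_le_of_A_ne_zero h) (not_le.2 hxy)

/-- No eigenvector of an unstable eigenvalue of `F_{i,d}` is annihilated by `H_{i,d}`. Such an
eigenvector is supported on the first remaining entry of each miniblock of its eigenvalue, and there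
the columns of `C_i` are the first nonzero columns of the blocks, which are independent. -/
lemma eq_zero_of_Fd_mulVec_eq_smul (hind : S.IndependentFirstColumns) (i : Fin N) (a : ℝ)
    (v : S.DIdx i → ℝ) (ha : 1 ≤ |a|) (hv : (S.Fd i).mulVec v = a • v)
    (hHv : (S.Hd i).mulVec v = 0) : v = 0 := by
  -- The extension of `v` by zero to all entries of the state.
  set w : J.State → ℝ := fun y => if h : y ∉ S.U i then v ⟨y, h⟩ else 0 with hwdef
  have hwD : ∀ y : S.DIdx i, w y = v y := fun y => dif_pos y.2
  have hwU : ∀ y ∈ S.U i, w y = 0 := fun y hy => dif_neg (not_not.2 hy)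
  have hA : ∀ x ∉ S.U i, J.A.mulVec w x = a * w x := by
    intro x hx
    have h := congrFun hv ⟨x, hx⟩
    rw [Pi.smul_apply, smul_eq_mul, ← hwD ⟨x, hx⟩] at h
    rw [← h, mulVec, mulVec, dotProduct, dotProduct, S.sum_state i,
      Finset.sum_eq_zero (s := (Finset.univ : Finset (S.UIdx i))), zero_add]
    · exact Finset.sum_congr rfl fun y _ => by rw [Fd_apply, hwD]
    · exact fun y _ => by rw [hwU y y.2, mul_zero]
  have hC : ∀ q, ∑ x, S.C i q x * w x = 0 := by
    intro q
    rw [S.sum_state i, Finset.sum_eq_zero (s := (Finset.univ : Finset (S.UIdx i))), zero_add]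
    · have h := congrFun hHv q
      rw [mulVec, dotProduct] at h
      rw [← Pi.zero_apply (M := fun _ => ℝ) q, ← h]
      exact Finset.sum_congr rfl fun y _ => by rw [Hd_apply, hwD]
    · exact fun y _ => by rw [hwU y y.2, mul_zero]
  have hstep : ∀ (b : J.Mini) (s : Fin (J.size b)), (⟨b, s⟩ : J.State) ∉ S.U i →
      (if h : (s : ℕ) + 1 < J.size b then w ⟨b, ⟨s + 1, h⟩⟩ else 0) =
        (a - J.eig b.1) * w ⟨b, s⟩ := by
    intro b s hs
    have := hA _ hs
    rw [J.A_mulVec_apply] at this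
    linarith
  have hne : ∀ b : J.Mini, J.eig b.1 ≠ a → ∀ s, w ⟨b, s⟩ = 0 := by
    intro b hb
    -- Backward substitution, from the last entry of the miniblock.
    have hrev : ∀ (c : ℕ) (s : Fin (J.size b)), J.size b ≤ s + c → w ⟨b, s⟩ = 0 := by
      intro c
      induction c with
      | zero => exact fun s hs => absurd s.2 (by omega)
      | succ c ih =>
        intro s hs
        by_cases hU : (⟨b, s⟩ : J.State) ∈ S.U i
        · exact hwU _ hU
        have h := hstep b s hU
        have h0 : (if h : (s : ℕ) + 1 < J.size b then w ⟨b, ⟨s + 1, h⟩⟩ else 0) = 0 := by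
          split_ifs with hlt
          · exact ih _ (by dsimp only; omega)
          · rfl
        rw [h0] at h
        exact (mul_eq_zero.1 h.symm).resolve_left (sub_ne_zero.2 hb.symm)
    exact fun s => hrev (J.size b) s (by omega)
  have heq : ∀ b : J.Mini, J.eig b.1 = a → ∀ s : Fin (J.size b),
      (s : ℕ) ≠ S.undetDim i b → w ⟨b, s⟩ = 0 := by
    intro b hb s hs
    by_cases hU : (⟨b, s⟩ : J.State) ∈ S.U i
    · exact hwU _ hU
    have hun : J.Unstable b.1 := by rw [JordanStructure.Unstable, hb]; exact ha
    have hlt : S.undetDim i b < s := by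
      have : ¬ (s : ℕ) < S.undetDim i b := fun h => hU (S.mem_U.2 ⟨hun, h⟩)
      omega
    obtain ⟨c, hc⟩ := Nat.exists_eq_succ_of_ne_zero (Nat.ne_of_gt (Nat.zero_lt_of_lt hlt))
    have hsz := s.2
    have h := hstep b ⟨c, by omega⟩ fun h => by
      have := (S.mem_U.1 h).2
      dsimp only at this
      omega
    rw [hb, sub_self, zero_mul, dif_pos (by dsimp only; omega)] at h
    rw [← h]
    exact congrArg (fun s => w ⟨b, s⟩) (Fin.ext hc)
  suffices hw : ∀ y, w y = 0 by
    funext y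
    rw [← hwD, hw]
    rfl
  by_cases hex : ∃ ℓ, J.eig ℓ = a
  swap
  · rintro ⟨b, s⟩
    exact hne b (fun h => hex ⟨_, h⟩) s
  obtain ⟨ℓ, hℓ⟩ := hex
  have hun : J.Unstable ℓ := by rw [JordanStructure.Unstable, hℓ]; exact ha
  have hzero : ∀ h, S.blockC i ⟨ℓ, h⟩ = 0 → ∀ s, w ⟨⟨ℓ, h⟩, s⟩ = 0 := fun h hb s =>
    hwU _ (S.mem_U.2 ⟨hun, by rw [S.undetDim_of_blockC_eq_zero hb]; exact s.2⟩)
  -- Only the entry number `t` of the miniblock contributes to the sum, so that `g h` is its value.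
  set g : Fin (J.g ℓ) → ℝ := fun h => ∑ s, w ⟨⟨ℓ, h⟩, s⟩ with hg
  have hcan : ∀ h, S.blockC i ⟨ℓ, h⟩ ≠ 0 → ∀ s, w ⟨⟨ℓ, h⟩, s⟩ =
      canonicalVec (J.size ⟨ℓ, h⟩) (S.t i ⟨ℓ, h⟩) s * g h := by
    intro h hb s
    have ht := S.undetDim_add_one hb
    by_cases hs : (s : ℕ) + 1 = S.t i ⟨ℓ, h⟩
    · rw [canonicalVec, if_pos hs, one_mul]
      refine (Fintype.sum_eq_single (f := fun s => w ⟨⟨ℓ, h⟩, s⟩) s fun s' hs' =>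
        heq ⟨ℓ, h⟩ hℓ _ fun h' => hs' (Fin.ext ?_)).symm
      omega
    · rw [canonicalVec, if_neg hs, zero_mul]
      exact heq ⟨ℓ, h⟩ hℓ _ (by omega)
  have hlin := Fintype.linearIndependent_iff.1 (hind i ℓ hun) (fun h => g h.1) (by
    funext q
    rw [Finset.sum_apply, Pi.zero_apply, ← hC q, Fintype.sum_sigma, Fintype.sum_sigma,
      Fintype.sum_eq_single ℓ]
    · rw [← Fintype.sum_subtype_add_sum_subtype fun h => i ∈ S.V₂ ⟨ℓ, h⟩ ∪ S.V₃ ⟨ℓ, h⟩]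
      rw [Finset.sum_eq_zero (s := (Finset.univ :
        Finset {h // ¬ i ∈ S.V₂ ⟨ℓ, h⟩ ∪ S.V₃ ⟨ℓ, h⟩})), add_zero]
      · refine Finset.sum_congr rfl fun h _ => ?_
        rw [Pi.smul_apply, smul_eq_mul, mulVec, dotProduct, Finset.mul_sum]
        refine Finset.sum_congr rfl fun s _ => ?_
        rw [hcan h.1 (S.mem_V₂_union_V₃.1 h.2), blockC, of_apply]
        ring
      · intro h _
        refine Finset.sum_eq_zero fun s _ => ?_
        rw [hzero h.1 (not_not.1 fun hb => h.2 (S.mem_V₂_union_V₃.2 hb)), mul_zero]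
    · intro ℓ' hℓ'
      refine Finset.sum_eq_zero fun h _ => Finset.sum_eq_zero fun s _ => ?_
      rw [hne ⟨ℓ', h⟩ (fun h' => hℓ' (J.eig_injective (h'.trans hℓ.symm))), mul_zero])
  rintro ⟨⟨ℓ', h⟩, s⟩
  by_cases hℓ' : J.eig ℓ' = a
  · obtain rfl := J.eig_injective (hℓ'.trans hℓ.symm)
    by_cases hb : S.blockC i ⟨ℓ', h⟩ = 0
    · exact hzero h hb s
    · rw [hcan h hb s, hlin ⟨h, S.mem_V₂_union_V₃.2 hb⟩, mul_zero]
  · exact hne ⟨ℓ', h⟩ hℓ' s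

lemma isDetectable_Fd_Hd (hind : S.IndependentFirstColumns) (i : Fin N) :
    IsDetectable (S.Fd i) (S.Hd i) :=
  isDetectable_of_forall_eigenvector _ _ (splits_charpoly_Fd i) (eq_zero_of_Fd_mulVec_eq_smul hind i)

end SensorSystem

/-! ### The spectrum of the error dynamics -/

namespace SensorSystem

variable {J : JordanStructure} {N m : ℕ} {S : SensorSystem J N m}

variable (S) in
/-- The principal submatrix of the Laplacian on the agents for which the entry `x` of the state is
undetectable. -/
def entryLaplacian (G : WeightedDigraph N) (x : J.State) :
    Matrix {i : Fin N // x ∈ S.U i} {i : Fin N // x ∈ S.U i} ℝ :=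
  G.laplacian.submatrix Subtype.val Subtype.val

/-- The row `p = (i, s)` of the selection matrix is the unit vector of the entry `s` of agent `i`. -/
lemma sel_apply (b : J.Mini) (p : Σ i : {i : Fin N // i ∉ S.V₃ b}, Fin (S.undetDim i.1 b))
    (c : {i : Fin N // i ∉ S.V₃ b} × Fin (J.size b)) :
    S.sel b p c = if (p.1, Fin.castLE (S.undetDim_le p.1.1 b) p.2) = c then 1 else 0 := by
  obtain ⟨i, s⟩ := p
  obtain ⟨j, s'⟩ := c
  rw [sel, submatrix_apply, id, Equiv.sigmaEquivProd_symm_apply]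
  by_cases h : i = j
  · subst h
    rw [blockDiagonal'_apply_eq]
    simp [selAgent, Fin.ext_iff]
  · rw [blockDiagonal'_apply_ne _ _ _ h]
    simp [h]

/-- The coupling matrix only relates entries at the same position of the miniblock. -/
lemma couplingMatrix_apply (G : WeightedDigraph N) (b : J.Mini)
    (p q : Σ i : {i : Fin N // i ∉ S.V₃ b}, Fin (S.undetDim i.1 b)) :
    S.couplingMatrix G b p q =
      if (p.2 : ℕ) = q.2 then G.laplacian p.1 q.1 else 0 := by
  rw [couplingMatrix, mul_apply]
  simp only [mul_apply, transpose_apply, sel_apply, ite_mul, one_mul, zero_mul, mul_ite, mul_one,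
    mul_zero, Finset.sum_ite_eq, Finset.mem_univ, if_true, kroneckerMap_apply, reducedLaplacian,
    submatrix_apply, Matrix.one_apply]
  rw [Fintype.sum_eq_single (p.1, Fin.castLE (S.undetDim_le p.1.1 b) p.2)]
  · simp [Fin.ext_iff]
  · intro c hc
    rw [if_neg (Ne.symm hc), ite_self]

/-- Sorted by positions, the coupling matrix is block diagonal, with one principal submatrix of the
Laplacian for each position of the miniblock. -/
lemma mem_spectrum_couplingMatrix (G : WeightedDigraph N) {b : J.Mini} (hb : J.Unstable b.1)
    (μ : ℂ) : μ ∈ spectrum ℂ ((S.couplingMatrix G b).map (algebraMap ℝ ℂ)) ↔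
      ∃ s, μ ∈ spectrum ℂ ((S.entryLaplacian G ⟨b, s⟩).map (algebraMap ℝ ℂ)) := by
  have htri : (S.couplingMatrix G b).BlockTriangular fun p => (p.2 : ℕ) := fun p q hpq => by
    rw [couplingMatrix_apply, if_neg (Nat.ne_of_gt hpq)]
  have hblock : ∀ s : Fin (J.size b),
      spectrum ℂ (((S.couplingMatrix G b).toSquareBlock (fun p => (p.2 : ℕ)) s).map
        (algebraMap ℝ ℂ)) =
      spectrum ℂ ((S.entryLaplacian G ⟨b, s⟩).map (algebraMap ℝ ℂ)) := by
    intro s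
    let e : {i : Fin N // (⟨b, s⟩ : J.State) ∈ S.U i} ≃
        {p : Σ i : {i : Fin N // i ∉ S.V₃ b}, Fin (S.undetDim i.1 b) // (p.2 : ℕ) = s} :=
      { toFun := fun i => ⟨⟨⟨i.1, S.notMem_V₃_of_undetDim_pos
            (Nat.zero_lt_of_lt (S.mem_U.1 i.2).2)⟩, ⟨s, (S.mem_U.1 i.2).2⟩⟩, rfl⟩
        invFun := fun p => ⟨p.1.1.1, S.mem_U.2 ⟨hb, p.2.symm.trans_lt p.1.2.2⟩⟩
        left_inv := fun i => rfl
        right_inv := by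
          rintro ⟨⟨i, a⟩, ha⟩
          exact Subtype.ext (Sigma.ext rfl (heq_of_eq (Fin.ext ha.symm))) }
    rw [← spectrum_map_reindex e]
    congr 2
    ext p q
    rw [toSquareBlock_def, of_apply, couplingMatrix_apply, if_pos (p.2.trans q.2.symm)]
    rfl
  rw [mem_spectrum_iff_of_blockTriangular htri]
  constructor
  · rintro ⟨a, ha⟩
    by_cases h : a < J.size b
    · exact ⟨⟨a, h⟩, hblock ⟨a, h⟩ ▸ ha⟩
    · have : IsEmpty {p : Σ i : {i : Fin N // i ∉ S.V₃ b}, Fin (S.undetDim i.1 b) //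
          (p.2 : ℕ) = a} :=
        ⟨fun p => h (by have := p.1.2.2; have := p.2; have := S.undetDim_le p.1.1 b; omega)⟩
      rw [spectrum.of_subsingleton] at ha
      exact ha.elim
  · rintro ⟨s, hs⟩
    exact ⟨s, hblock s ▸ hs⟩

variable (S) in
/-- The sort key of the entries `(i, x)` of the joint estimation error that makes the error dynamics
block triangular: the undetectable entries come first, those of the same entry `x` of the state
together for all agents, and the detectable entries follow, agent by agent. -/
def errorKey (a : Fin N × J.State) : ℕ ×ₗ ℕ :=
  if a.2 ∈ S.U a.1 then J.stateKey a.2 else J.agentKey a.1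

lemma errorKey_eq_stateKey {a : Fin N × J.State} {x : J.State} :
    S.errorKey a = J.stateKey x ↔ a.2 ∈ S.U a.1 ∧ a.2 = x := by
  rw [errorKey]
  split_ifs with h
  · simp [h, J.stateKey_injective.eq_iff]
  · simp [h, (J.stateKey_lt_agentKey x a.1).ne']

lemma errorKey_eq_agentKey {a : Fin N × J.State} {i : Fin N} :
    S.errorKey a = J.agentKey i ↔ a.2 ∉ S.U a.1 ∧ a.1 = i := by
  rw [errorKey]
  split_ifs with h
  · simp [h, (J.stateKey_lt_agentKey a.2 i).ne]
  · simp [h, J.agentKey_injective.eq_iff]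

/-- Rows of undetectable entries refer to the same or the next position of the same miniblock or to
detectable entries; rows of detectable entries only to detectable entries of the same agent. -/
lemma errorMatrix_blockTriangular (G : WeightedDigraph N)
    (L : (i : Fin N) → Matrix (S.DIdx i) (Fin (S.p i)) ℝ) (k : J.Mini → ℝ) :
    (S.errorMatrix G L k).BlockTriangular S.errorKey := by
  rintro ⟨i, x⟩ ⟨j, y⟩ hlt
  rw [errorMatrix, of_apply]
  by_cases hx : x ∈ S.U i
  · rw [dif_pos hx]
    dsimp only
    have hA : J.A x y = 0 := by
      by_contra h
      refine absurd hlt (not_lt.2 ?_)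
      rw [errorKey, errorKey, if_pos hx]
      split_ifs
      · exact J.stateKey_le_of_A_ne_zero h
      · exact (J.stateKey_lt_agentKey x j).le
    simp [hA]
  · rw [dif_neg hx]
    dsimp only
    split_ifs with hij
    swap
    · rfl
    subst hij
    have hy : y ∈ S.U i := by
      by_contra hy
      rw [errorKey_eq_agentKey (a := (i, x)).2 ⟨hx, rfl⟩,
        errorKey_eq_agentKey (a := (i, y)).2 ⟨hy, rfl⟩] at hlt
      exact lt_irrefl _ hlt
    rw [S.A_eq_zero_of_notMem_of_mem hx hy, mul_apply]
    simp [S.C_eq_zero_of_mem_U hy]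

lemma spectrum_toSquareBlock_stateKey (G : WeightedDigraph N)
    (L : (i : Fin N) → Matrix (S.DIdx i) (Fin (S.p i)) ℝ) (k : J.Mini → ℝ) (x : J.State) :
    spectrum ℂ (((S.errorMatrix G L k).toSquareBlock S.errorKey (J.stateKey x)).map
        (algebraMap ℝ ℂ)) =
      spectrum ℂ ((J.eig x.1.1 • (1 - k x.1 • S.entryLaplacian G x)).map (algebraMap ℝ ℂ)) := by
  let e : {i : Fin N // x ∈ S.U i} ≃ {a // S.errorKey a = J.stateKey x} :=
    { toFun := fun i => ⟨(i.1, x), errorKey_eq_stateKey.2 ⟨i.2, rfl⟩⟩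
      invFun := fun a => ⟨a.1.1, by
        obtain ⟨h1, h2⟩ := errorKey_eq_stateKey.1 a.2
        rwa [h2] at h1⟩
      left_inv := fun i => rfl
      right_inv := fun a => Subtype.ext (Prod.ext rfl (errorKey_eq_stateKey.1 a.2).2.symm) }
  rw [← spectrum_map_reindex e.symm]
  congr 2
  ext i j
  have hA : J.A x x = J.eig x.1.1 := by rw [J.A_apply_same, if_pos rfl]
  have : (S.errorMatrix G L k) (i.1, x) (j.1, x) =
      (J.eig x.1.1 • (1 - k x.1 • S.entryLaplacian G x)) i j := by
    rw [errorMatrix, of_apply, dif_pos i.2]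
    simp only [i.2, if_true, hA, Matrix.smul_apply, Matrix.sub_apply, Matrix.one_apply, smul_eq_mul,
      entryLaplacian, submatrix_apply, Subtype.ext_iff]
    split_ifs <;> ring
  rw [← this]
  rfl

lemma spectrum_toSquareBlock_detectable (G : WeightedDigraph N)
    (L : (i : Fin N) → Matrix (S.DIdx i) (Fin (S.p i)) ℝ) (k : J.Mini → ℝ) (i : Fin N) :
    spectrum ℂ (((S.errorMatrix G L k).toSquareBlock S.errorKey
        (J.agentKey i)).map (algebraMap ℝ ℂ)) =
      spectrum ℂ ((S.Fd i - L i * S.Hd i).map (algebraMap ℝ ℂ)) := by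
  let e : S.DIdx i ≃ {a // S.errorKey a = J.agentKey i} :=
    { toFun := fun x => ⟨(i, x.1), errorKey_eq_agentKey.2 ⟨x.2, rfl⟩⟩
      invFun := fun a => ⟨a.1.2, by
        obtain ⟨h1, h2⟩ := errorKey_eq_agentKey.1 a.2
        rwa [h2] at h1⟩
      left_inv := fun i => rfl
      right_inv := fun a => Subtype.ext (Prod.ext (errorKey_eq_agentKey.1 a.2).2.symm rfl) }
  rw [← spectrum_map_reindex e.symm]
  congr 2
  ext x y
  have : (S.errorMatrix G L k) (i, x.1) (i, y.1) = (S.Fd i - L i * S.Hd i) x y := by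
    rw [errorMatrix, of_apply, dif_neg x.2]
    simp [Fd_apply, mul_apply, Hd_apply]
  rw [← this]
  rfl

/-- The eigenvalues of the error dynamics are the `λ (1 - k μ)`, `μ` an eigenvalue of the coupling
matrix of an unstable miniblock, and the eigenvalues of the Luenberger error dynamics. -/
lemma mem_spectrum_errorMatrix (G : WeightedDigraph N)
    (L : (i : Fin N) → Matrix (S.DIdx i) (Fin (S.p i)) ℝ) (k : J.Mini → ℝ) (μ : ℂ) :
    μ ∈ spectrum ℂ ((S.errorMatrix G L k).map (algebraMap ℝ ℂ)) ↔
      (∃ b : J.Mini, J.Unstable b.1 ∧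
        ∃ ν ∈ spectrum ℂ ((S.couplingMatrix G b).map (algebraMap ℝ ℂ)),
          (J.eig b.1 : ℂ) * (1 - k b * ν) = μ) ∨
      ∃ i, μ ∈ spectrum ℂ ((S.Fd i - L i * S.Hd i).map (algebraMap ℝ ℂ)) := by
  rw [mem_spectrum_iff_of_blockTriangular (errorMatrix_blockTriangular G L k)]
  constructor
  · rintro ⟨key, h⟩
    rcases isEmpty_or_nonempty {a // S.errorKey a = key} with hemp | ⟨⟨⟨i, x⟩, rfl⟩⟩
    · rw [spectrum.of_subsingleton] at h
      exact h.elim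
    by_cases hx : x ∈ S.U i
    · rw [errorKey_eq_stateKey (a := (i, x)).2 ⟨hx, rfl⟩, spectrum_toSquareBlock_stateKey,
        mem_spectrum_smul_one_sub_smul] at h
      obtain ⟨ν, hν, rfl⟩ := h
      have hb := (S.mem_U.1 hx).1
      exact Or.inl ⟨x.1, hb, ν, (mem_spectrum_couplingMatrix G hb ν).2 ⟨x.2, hν⟩, rfl⟩
    · rw [errorKey_eq_agentKey (a := (i, x)).2 ⟨hx, rfl⟩, spectrum_toSquareBlock_detectable] at h
      exact Or.inr ⟨i, h⟩
  · rintro (⟨b, hb, ν, hν, rfl⟩ | ⟨i, h⟩)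
    · obtain ⟨s, hs⟩ := (mem_spectrum_couplingMatrix G hb ν).1 hν
      refine ⟨J.stateKey ⟨b, s⟩, ?_⟩
      rw [spectrum_toSquareBlock_stateKey, mem_spectrum_smul_one_sub_smul]
      exact ⟨ν, hs, rfl⟩
    · refine ⟨J.agentKey i, ?_⟩
      rwa [spectrum_toSquareBlock_detectable]

end SensorSystem

end DistributedObserver

end

theorem theorem1 (J : DistributedObserver.JordanStructure) (N m : ℕ)
    (S : DistributedObserver.SensorSystem J N m)
    (G : DistributedObserver.WeightedDigraph N)
    (hdet : S.JointlyDetectable) (hind : S.IndependentFirstColumns) :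
    (∃ (L : (i : Fin N) → Matrix (S.DIdx i) (Fin (S.p i)) ℝ) (k : J.Mini → ℝ),
        S.IsDistributedObserver G L k) ↔
      ∀ b : J.Mini, J.Unstable b.1 →
        ∃ k : ℝ, ∀ μ ∈ spectrum ℂ ((S.couplingMatrix G b).map (algebraMap ℝ ℂ)),
          ‖1 - (k : ℂ) * μ‖ < 1 / |J.eig b.1| := by
  have hnorm : ∀ b : J.Mini, J.Unstable b.1 → ∀ z : ℂ,
      ‖(J.eig b.1 : ℂ) * z‖ < 1 ↔ ‖z‖ < 1 / |J.eig b.1| := by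
    intro b hb z
    rw [norm_mul, Complex.norm_real, Real.norm_eq_abs, lt_div_iff₀ (one_pos.trans_le hb), mul_comm]
  simp only [DistributedObserver.SensorSystem.isDistributedObserver_iff_isSchur,
    DistributedObserver.IsSchur, DistributedObserver.SensorSystem.mem_spectrum_errorMatrix]
  constructor
  · rintro ⟨L, k, h⟩ b hb
    exact ⟨k b, fun μ hμ => (hnorm b hb _).1 (h _ (Or.inl ⟨b, hb, μ, hμ, rfl⟩))⟩
  · intro h
    choose! k hk using h
    choose L hL using DistributedObserver.SensorSystem.isDetectable_Fd_Hd hind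
    refine ⟨L, k, ?_⟩
    rintro _ (⟨b, hb, μ, hμ, rfl⟩ | ⟨i, hi⟩)
    · exact (hnorm b hb _).2 (hk b hb μ hμ)
    · exact hL i _ hi
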